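/- Assume the generalized continuum hypothesis, $2^{\nu}=\nu^{+}$ for every infinite cardinal $\nu$. A graph here is undirected, without loops or multiple edges; for a cardinal $\kappa$, a graph is $K(\kappa)$-free if no set of exactly $\kappa$ of its vertices is a clique (i.e. consists of pairwise adjacent vertices). A $(\lambda,\kappa)$-graph is a $K(\kappa)$-free graph with exactly $\lambda$ vertices. A weak embedding of a graph $Y$ into a graph $X$ is an injective map of vertices that sends edges to edges; a strong embedding is an injective map such that two vertices are adjacent in $Y$ if and only if their images are adjacent in $X$. A weakly (strongly) universal $(\lambda,\kappa)$-graph is a $(\lambda,\kappa)$-graph into which every $(\lambda,\kappa)$-graph has a weak (strong) embedding. Let $\lambda$ be an infinite cardinal and let $\kappa$ be a cardinal, finite or infinite, with $2\le\kappa\le\lambda$. Then the following are equivalent: 1. there is a weakly universal $(\lambda,\kappa)$-graph; 2. there is a strongly universal $(\lambda,\kappa)$-graph; 3. $\kappa$ is finite or $\operatorname{cf}(\kappa)>\operatorname{cf}(\lambda)$. -/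

import Mathlib

universe u

open Cardinal

/-- The generalized continuum hypothesis: `2 ^ c = c⁺` for every infinite cardinal `c`. -/
def GCH : Prop :=
  ∀ c : Cardinal.{u}, ℵ₀ ≤ c → (2 : Cardinal.{u}) ^ c = Order.succ c

/-- `X` is `K(κ)`-free: no set of exactly `κ` vertices is a clique. -/
def IsKFree {V : Type u} (X : SimpleGraph V) (κ : Cardinal.{u}) : Prop :=
  ∀ T : Set V, #T = κ → ¬ X.IsClique T

/-- A `(μ, κ)`-graph: a `K(κ)`-free graph with exactly `μ` vertices. -/
def IsSizedKFree (μ κ : Cardinal.{u}) {V : Type u} (X : SimpleGraph V) : Prop :=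
  #V = μ ∧ IsKFree X κ

/-- `X` is a weakly universal `(μ, κ)`-graph: it is a `(μ, κ)`-graph, and every `(μ, κ)`-graph
has an injective edge-preserving map into it. -/
def IsWeaklyUniversal (μ κ : Cardinal.{u}) {V : Type u} (X : SimpleGraph V) : Prop :=
  IsSizedKFree μ κ X ∧
    ∀ (W : Type u) (Y : SimpleGraph W), IsSizedKFree μ κ Y → SimpleGraph.IsContained Y X

/-- `X` is a strongly universal `(μ, κ)`-graph: it is a `(μ, κ)`-graph, and every `(μ, κ)`-graph
has an injective map into it that preserves both edges and non-edges. -/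
def IsStronglyUniversal (μ κ : Cardinal.{u}) {V : Type u} (X : SimpleGraph V) : Prop :=
  IsSizedKFree μ κ X ∧
    ∀ (W : Type u) (Y : SimpleGraph W), IsSizedKFree μ κ Y → SimpleGraph.IsIndContained Y X

open Set

/-! Sufficiency: a vertex guesses the part of an arbitrary `K(κ)`-free graph up to its own rank,
where ranks take at most cf(μ) values. GCH leaves only μ guesses, and giving each vertex its true
guess is a strong embedding. A clique with a member of top rank lives inside that member's guess,
hence is small. Finiteness of κ supplies such a member; if cf(μ) < cf(κ), pigeonhole yields κ
members of one rank (`isKFree_coherentGraph`).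

Necessity: let cf(κ) ≤ cf(μ). The non-cofinal cliques of a candidate `X`, at most μ of them by GCH,
index a `K(κ)`-free graph with cf(κ) levels (`isKFree_cliqueGraph`). A copy of it in `X` would
extend each such clique by the image of the block over it, and iterating through all levels would
build a clique of size at least κ in `X` (`isEmpty_copy_cliqueGraph`). -/

theorem GCH.two_power_le (h : GCH.{u}) {μ c : Cardinal.{u}} (hμ : ℵ₀ ≤ μ) (hc : c < μ) :
    (2 : Cardinal.{u}) ^ c ≤ μ := by
  rcases lt_or_ge c ℵ₀ with hfin | hinf
  · exact (power_lt_aleph0 (natCast_lt_aleph0 (n := 2)) hfin).le.trans hμ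
  · rw [h c hinf]
    exact Order.succ_le_of_lt hc

theorem IsKFree.mk_lt {V : Type u} {X : SimpleGraph V} {κ : Cardinal.{u}} (h : IsKFree X κ)
    {T : Set V} (hT : X.IsClique T) : #T < κ := by
  by_contra! hle
  obtain ⟨S, hST, hS⟩ := le_mk_iff_exists_subset.1 hle
  exact h S hS (hT.subset hST)

theorem isKFree_of_mk_lt {V : Type u} {X : SimpleGraph V} {κ : Cardinal.{u}}
    (h : ∀ T : Set V, X.IsClique T → #T < κ) : IsKFree X κ :=
  fun T hT hc => (h T hc).ne hT

theorem IsKFree.of_hom {V W : Type u} {X : SimpleGraph V} {Y : SimpleGraph W} {κ : Cardinal.{u}}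
    (h : IsKFree X κ) (f : Y →g X) : IsKFree Y κ := by
  refine isKFree_of_mk_lt fun T hT => ?_
  have hinj : InjOn f T := fun x hx y hy hxy => by
    by_contra hne
    exact (f.map_adj (hT hx hy hne)).ne hxy
  rw [← mk_image_eq_of_injOn f T hinj]
  refine h.mk_lt ?_
  rintro _ ⟨x, hx, rfl⟩ _ ⟨y, hy, rfl⟩ hne
  exact f.map_adj (hT hx hy fun e => hne (e ▸ rfl))

/-! ### The universal graph of coherent guesses -/

section Universal

variable {L : Type u} [LinearOrder L] (b : L → L)

/-- The graph obtained from `G` by deleting all edges with an endpoint of rank above `i`. -/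
def SimpleGraph.truncate (G : SimpleGraph L) (i : L) : SimpleGraph L where
  Adj x y := G.Adj x y ∧ b x ≤ i ∧ b y ≤ i
  symm := ⟨fun _ _ h => ⟨h.1.symm, h.2.2, h.2.1⟩⟩
  loopless := ⟨fun _ h => h.1.ne rfl⟩

theorem SimpleGraph.truncate_le (G : SimpleGraph L) (i : L) : G.truncate b i ≤ G :=
  fun _ _ h => h.1

theorem SimpleGraph.truncate_truncate (G : SimpleGraph L) {i j : L} (h : i ≤ j) :
    (G.truncate b j).truncate b i = G.truncate b i := by
  ext x y
  simp only [SimpleGraph.truncate]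
  exact ⟨fun ⟨⟨h1, _⟩, h2⟩ => ⟨h1, h2⟩, fun ⟨h1, h2, h3⟩ => ⟨⟨h1, h2.trans h, h3.trans h⟩, h2, h3⟩⟩

/-- Vertices `v` of `L` together with a `K(κ)`-free graph on the elements of rank at most `b v`. -/
def CoherentVertex (κ : Cardinal.{u}) : Type u :=
  {p : L × SimpleGraph L // IsKFree p.2 κ ∧ p.2.truncate b (b p.1) = p.2}

/-- Two vertices are joined if the graphs they carry cohere and the larger one joins them. -/
def coherentGraph (κ : Cardinal.{u}) : SimpleGraph (CoherentVertex b κ) :=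
  SimpleGraph.fromRel fun p q =>
    b p.1.1 ≤ b q.1.1 ∧ q.1.2.truncate b (b p.1.1) = p.1.2 ∧ q.1.2.Adj p.1.1 q.1.1

variable {b} {κ : Cardinal.{u}}

theorem coherentGraph_adj_of_le {p q : CoherentVertex b κ} (h : (coherentGraph b κ).Adj p q)
    (hpq : b p.1.1 ≤ b q.1.1) :
    q.1.2.truncate b (b p.1.1) = p.1.2 ∧ q.1.2.Adj p.1.1 q.1.1 := by
  obtain ⟨-, h | ⟨h1, h2, h3⟩⟩ := (SimpleGraph.fromRel_adj _ _ _).1 h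
  · exact h.2
  · have e : b p.1.1 = b q.1.1 := hpq.antisymm h1
    have e' : p.1.2 = q.1.2 := by rw [← h2, ← e, p.2.2]
    exact ⟨by rw [e, q.2.2, e'], e' ▸ h3.symm⟩

/-- By coherence `w`'s graph contains those of all members, so first coordinates carry `T`
injectively to a clique of it. -/
theorem mk_clique_lt_of_forall_le {T : Set (CoherentVertex b κ)}
    (hT : (coherentGraph b κ).IsClique T) {w : CoherentVertex b κ} (hw : w ∈ T)
    (hmax : ∀ v ∈ T, b v.1.1 ≤ b w.1.1) : #T < κ := by
  have htr : ∀ v ∈ T, v.1.2 ≤ w.1.2 := by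
    intro v hv
    rcases eq_or_ne v w with rfl | hne
    · exact le_rfl
    · rw [← (coherentGraph_adj_of_le (hT hv hw hne) (hmax v hv)).1]
      exact SimpleGraph.truncate_le _ _ _
  have hadj : ∀ p ∈ T, ∀ q ∈ T, p ≠ q → w.1.2.Adj p.1.1 q.1.1 := by
    intro p hp q hq hne
    rcases le_total (b p.1.1) (b q.1.1) with h | h
    · exact htr q hq (coherentGraph_adj_of_le (hT hp hq hne) h).2
    · exact (htr p hp (coherentGraph_adj_of_le (hT hq hp hne.symm) h).2).symm
  have hinj : InjOn (fun p : CoherentVertex b κ => p.1.1) T := fun p hp q hq e => by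
    by_contra hne
    exact (hadj p hp q hq hne).ne e
  rw [← mk_image_eq_of_injOn _ T hinj]
  refine w.2.1.mk_lt ?_
  rintro _ ⟨p, hp, rfl⟩ _ ⟨q, hq, rfl⟩ hne
  exact hadj p hp q hq fun e => hne (e ▸ rfl)

theorem isKFree_coherentGraph (hκ : 2 ≤ κ) (hb : κ < ℵ₀ ∨ #(range b) < κ.ord.cof) :
    IsKFree (coherentGraph b κ) κ := by
  intro T hTκ hT
  rcases lt_or_ge κ ℵ₀ with hfin | hinf
  · have hne : T.Nonempty := by
      rw [nonempty_iff_ne_empty]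
      rintro rfl
      rw [mk_eq_zero] at hTκ
      exact absurd (hTκ ▸ hκ) (by simp)
    obtain ⟨w, hw, hmax⟩ :=
      T.exists_max_image (fun v => b v.1.1) (lt_aleph0_iff_set_finite.1 (hTκ.trans_lt hfin)) hne
    exact (mk_clique_lt_of_forall_le hT hw hmax).ne hTκ
  · obtain ⟨i, S, hST, hS, hi⟩ := infinite_pigeonhole_set
      (fun t : T => (⟨b t.1.1.1, mem_range_self _⟩ : range b)) κ hTκ.ge hinf
      (hb.resolve_left hinf.not_gt)
    have hne : S.Nonempty := by
      rw [nonempty_iff_ne_empty]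
      rintro rfl
      rw [mk_eq_zero] at hS
      exact absurd (hκ.trans hS) (by simp)
    obtain ⟨w, hw⟩ := hne
    refine (mk_clique_lt_of_forall_le (hT.subset hST) hw fun v hv => ?_).not_ge hS
    exact (congrArg Subtype.val ((hi hv).trans (hi hw).symm)).le

theorem isIndContained_coherentGraph {Y : SimpleGraph L} (hY : IsKFree Y κ) :
    Y.IsIndContained (coherentGraph b κ) := by
  let f : L → CoherentVertex b κ := fun v => ⟨(v, Y.truncate b (b v)),
    hY.of_hom (.ofLE (Y.truncate_le b _)), Y.truncate_truncate b le_rfl⟩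
  have hf : Function.Injective f := fun v w h => congrArg (fun p => p.1.1) h
  have key : ∀ {v w}, b v ≤ b w → ((coherentGraph b κ).Adj (f v) (f w) ↔ Y.Adj v w) := by
    intro v w hvw
    refine ⟨fun h => (coherentGraph_adj_of_le h hvw).2.1, fun h => ?_⟩
    refine (SimpleGraph.fromRel_adj _ _ _).2 ⟨fun e => h.ne (hf e), .inl ⟨hvw, ?_, h, hvw, le_rfl⟩⟩
    exact Y.truncate_truncate b hvw
  refine ⟨⟨⟨f, hf⟩, ?_⟩⟩
  intro v w
  rcases le_total (b v) (b w) with h | h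
  · exact key h
  · rw [SimpleGraph.adj_comm, Y.adj_comm]
    exact key h

/-- A carried graph is an edge set inside a square of size below `#L`, so GCH allows at most `#L` of
them per vertex. -/
theorem mk_coherentVertex (hGCH : GCH.{u}) (hL : ℵ₀ ≤ #L) (hκ : 2 ≤ κ)
    (hb : ∀ i, #{x | b x ≤ i} < #L) : #(CoherentVertex b κ) = #L := by
  apply le_antisymm
  · let S : L → Set (L × L) := fun v => {x | b x ≤ b v} ×ˢ {x | b x ≤ b v}
    have hS : ∀ v, #(𝒫 (S v)) ≤ #L := fun v => by
      rw [mk_powerset]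
      refine hGCH.two_power_le hL ?_
      rw [mk_setProd]
      exact mul_lt_of_lt hL (hb _) (hb _)
    let f : CoherentVertex b κ → Σ v, 𝒫 (S v) := fun p =>
      ⟨p.1.1, {e | p.1.2.Adj e.1 e.2}, fun e he => by
        have he' : (p.1.2.truncate b (b p.1.1)).Adj e.1 e.2 := by rw [p.2.2]; exact he
        exact he'.2⟩
    have hf : Function.Injective f := by
      rintro ⟨⟨v, G⟩, hG⟩ ⟨⟨w, H⟩, hH⟩ h
      obtain ⟨rfl, h2⟩ := Sigma.mk.inj_iff.1 h
      have h3 := congrArg Subtype.val (eq_of_heq h2)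
      have : G = H := by
        ext x y
        exact Set.ext_iff.1 h3 (x, y)
      subst this
      rfl
    calc #(CoherentVertex b κ) ≤ #(Σ v, 𝒫 (S v)) := mk_le_of_injective hf
      _ ≤ Cardinal.sum fun _ : L => #L := by rw [mk_sigma]; exact sum_le_sum _ _ hS
      _ = #L := by rw [sum_const', mul_eq_self hL]
  · refine mk_le_of_injective (f := fun v => (⟨(v, ⊥), ?_, ?_⟩ : CoherentVertex b κ))
      fun v w h => congrArg (fun p => p.1.1) h
    · refine isKFree_of_mk_lt fun T hT => ?_
      have : T.Subsingleton := fun x hx y hy => by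
        by_contra hne
        exact hT hx hy hne
      exact (mk_le_one_iff_set_subsingleton.2 this).trans_lt (Cardinal.one_lt_two.trans_le hκ)
    · ext x y
      simp [SimpleGraph.truncate]

end Universal

theorem IsKFree.comap {V W : Type u} {X : SimpleGraph V} {κ : Cardinal.{u}} (h : IsKFree X κ)
    (e : W ≃ V) : IsKFree (X.comap e) κ :=
  h.of_hom ⟨e, fun h => h⟩

theorem exists_isStronglyUniversal (hGCH : GCH.{u}) {μ κ : Cardinal.{u}} (hμ : ℵ₀ ≤ μ)
    (hκ : 2 ≤ κ) (h : κ < ℵ₀ ∨ μ.ord.cof < κ.ord.cof) :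
    ∃ (V : Type u) (X : SimpleGraph V), IsStronglyUniversal μ κ X := by
  let L := μ.ord.ToType
  have hL : #L = μ := mk_ord_toType μ
  have : NoMaxOrder L := noMaxOrder hμ
  obtain ⟨S, hS, hScard⟩ := Order.exists_cof_eq L
  -- Strictness puts the elements of rank at most `i` inside `Iio i`, which has size below μ.
  have hex : ∀ x : L, ∃ s ∈ S, x < s := fun x => by
    obtain ⟨y, hy⟩ := exists_gt x
    obtain ⟨s, hs, hys⟩ := hS y
    exact ⟨s, hs, hy.trans_le hys⟩
  choose b hbS hb using hex
  refine ⟨CoherentVertex b κ, coherentGraph b κ, ⟨?_, ?_⟩, ?_⟩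
  · rw [mk_coherentVertex hGCH (hL ▸ hμ) hκ, hL]
    intro i
    refine (mk_le_mk_of_subset fun x hx => (hb x).trans_le hx).trans_lt (mk_Iio_lt i ?_)
    rw [hL, Ordinal.type_toType]
  · refine isKFree_coherentGraph hκ (h.imp_right fun h => lt_of_le_of_lt ?_ h)
    rw [← Ordinal.cof_toType, ← hScard]
    exact mk_le_mk_of_subset (range_subset_iff.2 hbS)
  · rintro W Y ⟨hW, hY⟩
    obtain ⟨e⟩ := Cardinal.eq.1 (hL.trans hW.symm)
    exact (SimpleGraph.Iso.comap e Y).symm.isIndContained.trans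
      (isIndContained_coherentGraph (hY.comap e))

/-! ### The graph of cliques that defeats a candidate -/

section Obstruction

variable {I E L : Type u} [LinearOrder I] [LinearOrder L]

/-- A vertex `(i, e, C)` records a non-cofinal clique `C` of `X` together with an index `e` in the
`i`-th block. -/
def CliqueVertex (X : SimpleGraph L) (D : I → Set E) : Type u :=
  {p : I × E × Set L // p.2.1 ∈ D p.1 ∧ ¬ IsCofinal p.2.2 ∧ X.IsClique p.2.2}

/-- The vertices over the same block and the same clique are joined, and so are those over
sufficiently increasing cliques in increasing blocks. -/
def cliqueGraph (X : SimpleGraph L) (D : I → Set E) (a : I → Cardinal.{u}) :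
    SimpleGraph (CliqueVertex X D) :=
  SimpleGraph.fromRel fun p q => (p.1.1 = q.1.1 ∧ p.1.2.2 = q.1.2.2) ∨
    (p.1.1 < q.1.1 ∧ p.1.2.2 ⊆ q.1.2.2 ∧ a p.1.1 ≤ #(q.1.2.2 \ p.1.2.2 : Set L))

variable {X : SimpleGraph L} {D : I → Set E} {a : I → Cardinal.{u}} {κ : Cardinal.{u}}

theorem cliqueGraph_adj_of_eq {p q : CliqueVertex X D} (h : (cliqueGraph X D a).Adj p q)
    (hpq : p.1.1 = q.1.1) : p.1.2.2 = q.1.2.2 := by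
  obtain ⟨-, (h | h) | (h | h)⟩ := (SimpleGraph.fromRel_adj _ _ _).1 h
  · exact h.2
  · exact absurd hpq h.1.ne
  · exact h.2.symm
  · exact absurd hpq h.1.ne'

theorem cliqueGraph_adj_of_lt {p q : CliqueVertex X D} (h : (cliqueGraph X D a).Adj p q)
    (hpq : p.1.1 < q.1.1) :
    p.1.2.2 ⊆ q.1.2.2 ∧ a p.1.1 ≤ #(q.1.2.2 \ p.1.2.2 : Set L) := by
  obtain ⟨-, (h | h) | (h | h)⟩ := (SimpleGraph.fromRel_adj _ _ _).1 h
  · exact absurd h.1 hpq.ne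
  · exact h.2
  · exact absurd h.1 hpq.ne'
  · exact absurd h.1 hpq.not_gt

theorem cliqueGraph_subset_of_le {T : Set (CliqueVertex X D)}
    (hT : (cliqueGraph X D a).IsClique T) {p q : CliqueVertex X D} (hp : p ∈ T) (hq : q ∈ T)
    (hpq : p.1.1 ≤ q.1.1) : p.1.2.2 ⊆ q.1.2.2 := by
  rcases eq_or_ne p q with rfl | hne
  · exact Subset.rfl
  · rcases hpq.eq_or_lt with h | h
    · exact (cliqueGraph_adj_of_eq (hT hp hq hne) h).subset
    · exact (cliqueGraph_adj_of_lt (hT hp hq hne) h).1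

/-- Otherwise fewer than cf(κ) levels are met, so at least κ vertices share a level. They then share
their clique and differ only by an index in a set of size below κ. -/
theorem isCofinal_image_of_isClique (hκ : ℵ₀ ≤ κ) (hI : ∀ i : I, #(Iic i) < κ.ord.cof)
    (hD : ∀ i, #(D i) < κ) {T : Set (CliqueVertex X D)} (hT : (cliqueGraph X D a).IsClique T)
    (hTκ : #T = κ) : IsCofinal ((fun p : CliqueVertex X D => p.1.1) '' T) := by
  by_contra hcof
  obtain ⟨i, hi⟩ := not_isCofinal_iff.1 hcof
  obtain ⟨j, S, hST, hS, hj⟩ := infinite_pigeonhole_set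
    (fun t : T => (⟨t.1.1.1, (hi _ ⟨t.1, t.2, rfl⟩).le⟩ : Iic i)) κ hTκ.ge hκ (hI i)
  have hj' : ∀ x ∈ S, x.1.1 = j.1 := fun x hx => congrArg Subtype.val (hj hx)
  refine ((mk_le_of_injective (f := fun x : S => (⟨x.1.1.2.1, ?_⟩ : D j.1)) ?_).trans_lt
    (hD j.1)).not_ge hS
  · rw [← hj' x.1 x.2]
    exact x.1.2.1
  · intro x y hxy
    by_contra hne
    have hne' : x.1 ≠ y.1 := fun e => hne (Subtype.ext e)
    have h1 : x.1.1.1 = y.1.1.1 := (hj' _ x.2).trans (hj' _ y.2).symm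
    have h3 := cliqueGraph_adj_of_eq (hT (hST x.2) (hST y.2) hne') h1
    have h2 : x.1.1.2.1 = y.1.1.2.1 := congrArg Subtype.val hxy
    exact hne' (Subtype.ext (Prod.ext h1 (Prod.ext h2 h3)))

/-- The cliques recorded along `T` form a chain, so their union is a clique of `X`. The gaps make it
at least as large as the set of levels met and as each `a j`; by `hJ` it has size at least κ. -/
theorem isKFree_cliqueGraph [WellFoundedLT I] [NoMaxOrder I] (hκ : ℵ₀ ≤ κ)
    (hI : ∀ i : I, #(Iic i) < κ.ord.cof) (hD : ∀ i, #(D i) < κ) (ha : ∀ i, 1 ≤ a i)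
    (hJ : ∀ J : Set I, IsCofinal J → ∀ c, #J ≤ c → (∀ j ∈ J, a j ≤ c) → κ ≤ c)
    (hX : IsKFree X κ) : IsKFree (cliqueGraph X D a) κ := by
  intro T hTκ hT
  let J : Set I := (fun p : CliqueVertex X D => p.1.1) '' T
  have hJcof : IsCofinal J := isCofinal_image_of_isClique hκ hI hD hT hTκ
  let U : Set L := ⋃ t ∈ T, t.1.2.2
  have hU : X.IsClique U := by
    intro x hx y hy hxy
    obtain ⟨s, hs, hxs⟩ := mem_iUnion₂.1 hx
    obtain ⟨t, ht, hyt⟩ := mem_iUnion₂.1 hy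
    rcases le_total s.1.1 t.1.1 with h | h
    · exact t.2.2.2 (cliqueGraph_subset_of_le hT hs ht h hxs) hyt hxy
    · exact s.2.2.2 hxs (cliqueGraph_subset_of_le hT ht hs h hyt) hxy
  have hsub : ∀ t ∈ T, t.1.2.2 ⊆ U := fun t ht => subset_biUnion_of_mem (u := fun t => t.1.2.2) ht
  have hgap : ∀ s ∈ T, ∀ t ∈ T, s.1.1 < t.1.1 → a s.1.1 ≤ #(t.1.2.2 \ s.1.2.2 : Set L) :=
    fun s hs t ht h => (cliqueGraph_adj_of_lt (hT hs ht fun e => h.ne (e ▸ rfl)) h).2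
  have hnext : ∀ j : I, ∃ t ∈ T, j < t.1.1 := fun j => by
    obtain ⟨k, hk⟩ := exists_gt j
    obtain ⟨_, ⟨t, ht, rfl⟩, hkt⟩ := hJcof k
    exact ⟨t, ht, hk.trans_le hkt⟩
  refine (hX.mk_lt hU).not_ge (hJ J hJcof _ ?_ ?_)
  -- A point new at the next level met after `j` lies in all later cliques and in none at level `j`,
  -- so these points are distinct.
  · have hpick : ∀ j : J, ∃ x ∈ U, (∀ s ∈ T, s.1.1 = j.1 → x ∉ s.1.2.2) ∧
        ∀ s ∈ T, j.1 < s.1.1 → x ∈ s.1.2.2 := by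
      rintro ⟨_, p, hp, rfl⟩
      obtain ⟨k, ⟨t, ht, rfl, hpt⟩, hmin⟩ := WellFounded.has_min (wellFounded_lt (α := I))
        {k | ∃ t ∈ T, t.1.1 = k ∧ p.1.1 < t.1.1}
        (let ⟨t, ht, h⟩ := hnext p.1.1; ⟨t.1.1, t, ht, rfl, h⟩)
      have hne : (t.1.2.2 \ p.1.2.2).Nonempty := by
        rw [← nonempty_coe_sort, ← mk_ne_zero_iff]
        exact (zero_lt_one.trans_le ((ha _).trans (hgap p hp t ht hpt))).ne'
      obtain ⟨x, hxt, hxp⟩ := hne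
      refine ⟨x, hsub t ht hxt, fun s hs hsp hxs => hxp ?_, fun s hs hps => ?_⟩
      · exact cliqueGraph_subset_of_le hT hs hp hsp.le hxs
      · exact cliqueGraph_subset_of_le hT ht hs (not_lt.1 (hmin _ ⟨s, hs, rfl, hps⟩)) hxt
    choose x hxU hxnot hxmem using hpick
    refine mk_le_of_injective (f := fun j => (⟨x j, hxU j⟩ : U)) fun j k hjk => ?_
    have hjk' : x j = x k := congrArg Subtype.val hjk
    have key : ∀ j k : J, x j = x k → ¬ j.1 < k.1 := by
      rintro j ⟨_, t, ht, rfl⟩ h hlt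
      exact hxnot _ t ht rfl (h ▸ hxmem j t ht hlt)
    exact Subtype.ext (le_antisymm (not_lt.1 (key k j hjk'.symm)) (not_lt.1 (key j k hjk')))
  · rintro _ ⟨s, hs, rfl⟩
    obtain ⟨t, ht, hst⟩ := hnext s.1.1
    exact (hgap s hs t ht hst).trans (mk_le_mk_of_subset (sdiff_subset.trans (hsub t ht)))

/-- By recursion, `A i` is a large non-cofinal part of the image of the block over the union `C i`
of the earlier pieces. Each `C i` stays non-cofinal, being a union of fewer than `Order.cof L` such
pieces. -/
theorem isEmpty_copy_cliqueGraph [WellFoundedLT I]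
    (hI : ∀ i : I, #(Iio i) < Order.cof L) (ha : ∀ i, 1 ≤ a i)
    (hJ : ∀ c, #I ≤ c → (∀ j, a j ≤ c) → κ ≤ c)
    (hsub : ∀ i, ∀ A : Set L, #(D i) ≤ #A → ∃ B ⊆ A, ¬ IsCofinal B ∧ a i ≤ #B)
    (hX : IsKFree X κ) : IsEmpty (SimpleGraph.Copy (cliqueGraph X D a) X) := by
  refine ⟨fun F => ?_⟩
  let valid : Set L → Prop := fun C => ¬ IsCofinal C ∧ X.IsClique C
  -- The recursion is defined before validity is known, so an invalid `C` gets a dummy value.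
  have hstep : ∀ i C, ∃ B : Set L, valid C →
      (∀ x ∈ B, ∃ (e : E) (h : e ∈ D i ∧ valid C), F ⟨(i, e, C), h⟩ = x) ∧
        ¬ IsCofinal B ∧ a i ≤ #B := by
    intro i C
    by_cases hC : valid C
    · let g : D i → L := fun e => F ⟨(i, e.1, C), e.2, hC⟩
      have hg : Function.Injective g := fun e e' h => by
        have := congrArg (fun p => p.1.2.1) (F.injective h)
        exact Subtype.ext this
      obtain ⟨B, hB, hB'⟩ := hsub i (range g) (mk_range_eq g hg).ge
      refine ⟨B, fun _ => ⟨fun x hx => ?_, hB'⟩⟩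
      obtain ⟨e, rfl⟩ := hB hx
      exact ⟨e.1, ⟨e.2, hC⟩, rfl⟩
    · exact ⟨∅, fun h => absurd h hC⟩
  choose step hstep using hstep
  let A : I → Set L := (wellFounded_lt (α := I)).fix fun i A' =>
    step i (⋃ j : Iio i, A' j.1 j.2)
  let C : I → Set L := fun i => ⋃ j : Iio i, A j.1
  have hA : ∀ i, A i = step i (C i) := fun i => WellFounded.fix_eq _ _ i
  have hrep : ∀ i, valid (C i) → ∀ x ∈ A i,
      ∃ (e : E) (h : e ∈ D i ∧ valid (C i)), F ⟨(i, e, C i), h⟩ = x := fun i h x hx =>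
    (hstep i (C i) h).1 x (hA i ▸ hx)
  have hAcard : ∀ i, valid (C i) → a i ≤ #(A i) := fun i h => hA i ▸ (hstep i (C i) h).2.2
  have hdisj : ∀ i j, i < j → valid (C i) → valid (C j) → Disjoint (A i) (A j) := by
    intro i j hij hi hj
    rw [Set.disjoint_left]
    intro x hxi hxj
    obtain ⟨e, he, rfl⟩ := hrep i hi x hxi
    obtain ⟨e', he', h⟩ := hrep j hj _ hxj
    exact hij.ne' (congrArg (fun p => p.1.1) (F.injective h))
  have hmono : ∀ {i j}, i ≤ j → C i ⊆ C j := fun {i j} hij =>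
    iUnion_subset fun k => subset_iUnion (fun k : Iio j => A k.1) ⟨k.1, k.2.trans_le hij⟩
  have hadj : ∀ i j, i ≤ j → (∀ k ≤ j, valid (C k)) → ∀ x ∈ A i, ∀ y ∈ A j, x ≠ y →
      X.Adj x y := by
    intro i j hij hv x hx y hy hxy
    -- Injectivity of `F` makes the pieces disjoint, so `A i` itself fills the gap that adjacency
    -- requires.
    have hAC : i < j → A i ⊆ C j \ C i := fun h z hz => by
      refine ⟨mem_iUnion.2 ⟨⟨i, h⟩, hz⟩, fun hz' => ?_⟩
      obtain ⟨⟨k, hk⟩, hzk⟩ := mem_iUnion.1 hz'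
      exact Set.disjoint_left.1 (hdisj k i hk (hv k ((le_of_lt hk).trans hij)) (hv i hij)) hzk hz
    have hcard := hAcard i (hv i hij)
    obtain ⟨e, he, rfl⟩ := hrep i (hv i hij) x hx
    obtain ⟨e', he', rfl⟩ := hrep j (hv j le_rfl) y hy
    refine F.toHom.map_adj ((SimpleGraph.fromRel_adj _ _ _).2 ⟨fun h => hxy (congrArg F h), .inl ?_⟩)
    rcases hij.eq_or_lt with rfl | h
    · exact .inl ⟨rfl, rfl⟩
    · exact .inr ⟨h, hmono hij, hcard.trans (mk_le_mk_of_subset (hAC h))⟩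
  have hclique : ∀ s : Set I, (∀ i ∈ s, ∀ k ≤ i, valid (C k)) →
      X.IsClique (⋃ i : s, A i.1) := by
    intro s hs x hx y hy hxy
    obtain ⟨⟨i, hi⟩, hx⟩ := mem_iUnion.1 hx
    obtain ⟨⟨j, hj⟩, hy⟩ := mem_iUnion.1 hy
    rcases le_total i j with h | h
    · exact hadj i j h (hs j hj) x hx y hy hxy
    · exact (hadj j i h (hs i hi) y hy x hx hxy.symm).symm
  have hvalid : ∀ i, valid (C i) := by
    intro i
    induction i using WellFoundedLT.induction with
    | ind i ih =>
      refine ⟨fun hcof => ?_, hclique _ fun j hj k hk => ih k (hk.trans_lt hj)⟩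
      obtain ⟨⟨j, hj⟩, hcof⟩ := isCofinal_of_isCofinal_iUnion hcof (hI i)
      rw [hA] at hcof
      exact (hstep j (C j) (ih j hj)).2.1 hcof
  refine (hX.mk_lt (hclique univ fun i _ k _ => hvalid k)).not_ge (hJ _ ?_ fun j => ?_)
  · have hne : ∀ i, (A i).Nonempty := fun i => by
      rw [← nonempty_coe_sort, ← mk_ne_zero_iff]
      exact (zero_lt_one.trans_le ((ha i).trans (hAcard i (hvalid i)))).ne'
    choose x hx using hne
    refine mk_le_of_injective
      (f := fun i => (⟨x i, mem_iUnion.2 ⟨⟨i, mem_univ i⟩, hx i⟩⟩ : ⋃ i : univ, A i.1)) ?_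
    intro i j hij
    have hij' : x i = x j := congrArg Subtype.val hij
    rcases lt_trichotomy i j with h | h | h
    · exact absurd (hij' ▸ hx j)
        (Set.disjoint_left.1 (hdisj i j h (hvalid i) (hvalid j)) (hx i))
    · exact h
    · exact absurd (hij' ▸ hx i)
        (Set.disjoint_left.1 (hdisj j i h (hvalid j) (hvalid i)) (hx j))
  · exact (hAcard j (hvalid j)).trans
      (mk_le_mk_of_subset (subset_iUnion (fun i : (univ : Set I) => A i.1) ⟨j, mem_univ j⟩))

theorem mk_not_isCofinal_le (hGCH : GCH.{u}) (hL : ℵ₀ ≤ #L) (hIio : ∀ x : L, #(Iio x) < #L) :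
    #{C : Set L // ¬ IsCofinal C} ≤ #L := by
  calc #{C : Set L // ¬ IsCofinal C} ≤ #(⋃ x : L, 𝒫 (Iio x)) :=
        mk_le_mk_of_subset (s := {C : Set L | ¬ IsCofinal C}) fun C hC =>
          mem_iUnion.2 (not_isCofinal_iff.1 hC)
    _ ≤ Cardinal.sum fun x : L => #(𝒫 (Iio x)) := mk_iUnion_le_sum_mk
    _ ≤ Cardinal.sum fun _ : L => #L := by
        refine sum_le_sum _ _ fun x => ?_
        rw [mk_powerset]
        exact hGCH.two_power_le hL (hIio x)
    _ = #L := by rw [sum_const', mul_eq_self hL]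

theorem mk_cliqueVertex {I : Type u} {D : I → Set E} [NoMaxOrder L] (hGCH : GCH.{u}) (hL : ℵ₀ ≤ #L)
    (hIio : ∀ x : L, #(Iio x) < #L) (hI : #I ≤ #L) (hE : #E ≤ #L)
    (hD : ∃ i, (D i).Nonempty) : #(CliqueVertex X D) = #L := by
  apply le_antisymm
  · calc #(CliqueVertex X D) ≤ #(I × E × {C : Set L // ¬ IsCofinal C}) :=
          mk_le_of_injective (f := fun p => (p.1.1, p.1.2.1, ⟨p.1.2.2, p.2.2.1⟩)) fun p q h => by
            simp only [Prod.mk.injEq, Subtype.mk.injEq] at h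
            exact Subtype.ext (Prod.ext h.1 (Prod.ext h.2.1 h.2.2))
      _ ≤ #L * (#L * #L) := by
          simp only [mk_prod, lift_id]
          gcongr
          exact mk_not_isCofinal_le hGCH hL hIio
      _ = #L := by rw [mul_eq_self hL, mul_eq_self hL]
  · obtain ⟨i, e, he⟩ := hD
    refine mk_le_of_injective (f := fun x => (⟨(i, e, {x}), he, ?_, ?_⟩ : CliqueVertex X D)) ?_
    · rw [isCofinal_singleton_iff]
      exact not_isTop x
    · exact SimpleGraph.isClique_singleton x
    · intro x y h
      exact singleton_injective (congrArg (fun p => p.1.2.2) h)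

end Obstruction

/-! ### Cofinality estimates and the conclusion -/

/-- If κ ≤ `Order.cof L`, sets of size `a` are never cofinal. Otherwise κ is singular, hence a
limit, leaving room for the successor of `max a (Order.cof L)`; pigeonhole onto a minimal cofinal
set then bounds that many points at once. -/
theorem exists_not_isCofinal_subset {L : Type u} [LinearOrder L] [NoMaxOrder L] [Nonempty L]
    {κ a : Cardinal.{u}} (hκ : ℵ₀ ≤ κ) (hcof : κ.ord.cof ≤ Order.cof L) (ha : a < κ) :
    ∃ d < κ, ∀ A : Set L, d ≤ #A → ∃ B ⊆ A, ¬ IsCofinal B ∧ a ≤ #B := by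
  rcases le_or_gt κ (Order.cof L) with h | h
  · refine ⟨a, ha, fun A hA => ?_⟩
    obtain ⟨B, hBA, hB⟩ := le_mk_iff_exists_subset.1 hA
    exact ⟨B, hBA, fun hc => ((hB.trans_lt ha).trans_le h).not_ge (Order.cof_le hc), hB.ge⟩
  · have hsing : κ.IsSingular := ⟨hκ, (hcof.trans_lt h).ne⟩
    have hm : ℵ₀ ≤ max a (Order.cof L) := Order.aleph0_le_cof.trans (le_max_right _ _)
    refine ⟨Order.succ (max a (Order.cof L)), hsing.isSuccLimit.succ_lt (max_lt ha h),
      fun A hA => ?_⟩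
    obtain ⟨S, hS, hScard⟩ := Order.exists_cof_eq L
    choose g hgS hg using hS
    obtain ⟨s, B, hBA, hB, hBs⟩ := infinite_pigeonhole_set
      (fun x : A => (⟨g x, hgS x⟩ : S)) _ hA (hm.trans (Order.le_succ _))
      (by rw [(isRegular_succ hm).cof_ord, hScard]
          exact Order.lt_succ_of_le (le_max_right _ _))
    refine ⟨B, hBA, ?_, ((le_max_left _ _).trans (Order.le_succ _)).trans hB⟩
    rw [not_isCofinal_iff_bddAbove]
    exact ⟨s.1, fun x hx => (hg x).trans_eq (congrArg Subtype.val (hBs hx))⟩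

/-- For regular κ the size of `J` suffices. For singular κ and `c < κ`, some `j ∈ J` lies beyond the
initial ordinal of the successor of `c`, so `Iic j` is too large. -/
theorem le_of_isCofinal_of_forall_mk_Iic_le {κ c : Cardinal.{u}} (hκ : ℵ₀ ≤ κ)
    {J : Set κ.ord.ToType} (hJ : IsCofinal J) (hc : #J ≤ c) (hc' : ∀ j ∈ J, #(Iic j) ≤ c) :
    κ ≤ c := by
  rcases isRegular_or_isSingular hκ with h | h
  · rw [← h.cof_ord, ← Ordinal.cof_toType]
    exact (Order.cof_le hJ).trans hc
  · by_contra! hlt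
    have hs : Order.succ c < κ := h.isSuccLimit.succ_lt hlt
    obtain ⟨j, hj, hxj⟩ := hJ (Ordinal.ToType.mk ⟨(Order.succ c).ord, ord_lt_ord.2 hs⟩)
    refine (hc' j hj).not_gt (Order.succ_le_iff.1 ?_)
    let f : (Order.succ c).ord.ToType → Iic j := fun y =>
      ⟨Ordinal.ToType.mk ⟨Ordinal.ToType.mk.symm y,
          mem_Iio.2 (lt_trans (Ordinal.ToType.mk.symm y).2 (ord_lt_ord.2 hs))⟩,
        (Ordinal.ToType.mk.monotone (le_of_lt (Ordinal.ToType.mk.symm y).2)).trans hxj⟩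
    have hf : Function.Injective f := fun y z h => by
      have h1 := Ordinal.ToType.mk.injective (congrArg Subtype.val h)
      exact Ordinal.ToType.mk.symm.injective (Subtype.ext (Subtype.mk.inj h1))
    simpa using mk_le_of_injective hf

theorem not_isWeaklyUniversal (hGCH : GCH.{u}) {μ κ : Cardinal.{u}} (hμ : ℵ₀ ≤ μ) (hκμ : κ ≤ μ)
    (hκ : ℵ₀ ≤ κ) (hcof : κ.ord.cof ≤ μ.ord.cof) {V : Type u} (X : SimpleGraph V) :
    ¬ IsWeaklyUniversal μ κ X := by
  rintro ⟨⟨hV, hX⟩, huniv⟩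
  let L := μ.ord.ToType
  have hL : #L = μ := mk_ord_toType μ
  have hLmax : NoMaxOrder L := noMaxOrder hμ
  have hLne : Nonempty L := mk_ne_zero_iff.1 (hL ▸ (aleph0_pos.trans_le hμ).ne')
  let K := κ.ord.ToType
  have hK : #K = κ := mk_ord_toType κ
  have hKmax : NoMaxOrder K := noMaxOrder hκ
  have hKne : Nonempty K := mk_ne_zero_iff.1 (hK ▸ (aleph0_pos.trans_le hκ).ne')
  have hcofL : Order.cof L = μ.ord.cof := Ordinal.cof_toType _
  have hcofK : Order.cof K = κ.ord.cof := Ordinal.cof_toType _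
  obtain ⟨e⟩ := Cardinal.eq.1 (hL.trans hV.symm)
  -- Order type cf(κ) keeps every proper initial segment of `I` below cf(κ) in size.
  obtain ⟨I, hI, hIord⟩ := Ordinal.exists_ord_cof_eq K
  have hIcard : #I = κ.ord.cof := by
    rw [← hcofK, ← card_ord (Order.cof K), ← hIord, Ordinal.card_type]
  have hImax : NoMaxOrder I := ⟨fun i => by
    obtain ⟨x, hx⟩ := exists_gt i.1
    obtain ⟨j, hj, hxj⟩ := hI x
    exact ⟨⟨j, hj⟩, hx.trans_le hxj⟩⟩
  have hIne : Nonempty I := hI.nonempty.to_subtype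
  have hIio : ∀ i : I, #(Iio i) < κ.ord.cof := fun i =>
    hIcard ▸ mk_Iio_lt i (by rw [hIcard, hIord, hcofK])
  have hIic : ∀ i : I, #(Iic i) < κ.ord.cof := fun i => by
    obtain ⟨j, hj⟩ := exists_gt i
    exact (mk_le_mk_of_subset fun x hx => lt_of_le_of_lt hx hj).trans_lt (hIio j)
  have hKIic : ∀ x : K, #(Iic x) < κ := fun x => by
    obtain ⟨y, hy⟩ := exists_gt x
    refine (mk_le_mk_of_subset fun z hz => lt_of_le_of_lt hz hy).trans_lt
      ((mk_Iio_lt y ?_).trans_eq hK)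
    rw [hK, Ordinal.type_toType]
  let a : I → Cardinal.{u} := fun i => #(Iic i.1)
  have ha : ∀ i, 1 ≤ a i := fun i => Cardinal.one_le_iff_ne_zero.2 (mk_ne_zero_iff.2 ⟨⟨i.1, self_mem_Iic⟩⟩)
  have hblock : ∀ i, ∃ D : Set K, #D < κ ∧
      ∀ A : Set L, #D ≤ #A → ∃ B ⊆ A, ¬ IsCofinal B ∧ a i ≤ #B := fun i => by
    obtain ⟨d, hd, hdA⟩ := exists_not_isCofinal_subset (L := L) hκ
      (hcof.trans_eq hcofL.symm) (hKIic i.1)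
    obtain ⟨D, rfl⟩ := le_mk_iff_exists_set.1 (hd.le.trans_eq hK.symm)
    exact ⟨D, hd, hdA⟩
  choose D hD hDsub using hblock
  have hDne : ∀ i, (D i).Nonempty := fun i => by
    rw [nonempty_iff_ne_empty]
    intro h
    obtain ⟨B, hB, -, haB⟩ := hDsub i ∅ (by simp [h])
    obtain rfl := subset_empty_iff.1 hB
    rw [mk_eq_zero] at haB
    exact absurd ((ha i).trans haB) (by simp)
  have hJ : ∀ J : Set I, IsCofinal J → ∀ c, #J ≤ c → (∀ j ∈ J, a j ≤ c) → κ ≤ c := by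
    intro J hJ c hc hca
    refine le_of_isCofinal_of_forall_mk_Iic_le hκ (hI.trans hJ) (mk_image_le.trans hc) ?_
    rintro _ ⟨j, hj, rfl⟩
    exact hca j hj
  have hY := hX.comap e
  have hYsized : IsSizedKFree μ κ (cliqueGraph (X.comap e) D a) := by
    refine ⟨?_, isKFree_cliqueGraph hκ hIic hD ha hJ hY⟩
    rw [mk_cliqueVertex hGCH (hL ▸ hμ) (fun x => mk_Iio_lt x ?_), hL]
    · rw [hL, hIcard]
      exact (Ordinal.cof_ord_le κ).trans hκμ
    · rw [hL, hK]
      exact hκμ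
    · exact ⟨hIne.some, hDne _⟩
    · rw [hL, Ordinal.type_toType]
  obtain ⟨F⟩ := (huniv _ _ hYsized).trans ⟨(SimpleGraph.Iso.comap e X).symm.toCopy⟩
  refine (isEmpty_copy_cliqueGraph (fun i => ?_) ha (fun c hc hca => ?_) hDsub hY).false F
  · exact (hIio i).trans_le (hcof.trans_eq hcofL.symm)
  · exact hJ univ .univ c (by rwa [mk_univ]) fun j _ => hca j

theorem theorem1 (hGCH : GCH.{u}) (μ κ : Cardinal.{u}) (hμ : ℵ₀ ≤ μ) (hκμ : κ ≤ μ)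
    (hκ : 2 ≤ κ) :
    ((∃ (V : Type u) (X : SimpleGraph V), IsWeaklyUniversal μ κ X) ↔
      (κ < ℵ₀ ∨ μ.ord.cof < κ.ord.cof)) ∧
    ((∃ (V : Type u) (X : SimpleGraph V), IsStronglyUniversal μ κ X) ↔
      (κ < ℵ₀ ∨ μ.ord.cof < κ.ord.cof)) := by
  have hweak : ∀ (V : Type u) (X : SimpleGraph V), IsStronglyUniversal μ κ X →
      IsWeaklyUniversal μ κ X := fun V X h => ⟨h.1, fun W Y hY => (h.2 W Y hY).isContained⟩
  have hnec : (∃ (V : Type u) (X : SimpleGraph V), IsWeaklyUniversal μ κ X) →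
      κ < ℵ₀ ∨ μ.ord.cof < κ.ord.cof := by
    rintro ⟨V, X, hX⟩
    by_contra! h
    exact not_isWeaklyUniversal hGCH hμ hκμ h.1 h.2 X hX
  have hsuff := exists_isStronglyUniversal hGCH hμ hκ
  exact ⟨⟨hnec, fun h => let ⟨V, X, hX⟩ := hsuff h; ⟨V, X, hweak V X hX⟩⟩,
    ⟨fun ⟨V, X, hX⟩ => hnec ⟨V, X, hweak V X hX⟩, hsuff⟩⟩
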